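/- Let $G$ be a (discrete) group. Write $\mathcal{F}_{\mathrm{vc}}(G)$ for the family of virtually cyclic subgroups of $G$, i.e. of those subgroups that have a cyclic subgroup of finite index (finite subgroups included). A classifying space of $G$ for this family is a $G$-CW-complex $X$ such that, for every subgroup $H\le G$, the fixed point space $X^H$ is contractible if $H\in\mathcal{F}_{\mathrm{vc}}(G)$ and empty if $H\notin\mathcal{F}_{\mathrm{vc}}(G)$. Let $\mathrm{gd}_{\mathrm{vc}}(G)\in\{0,1,2,\dots\}\cup\{\infty\}$ be the least possible dimension of such a classifying space. Proposition. If $\mathrm{gd}_{\mathrm{vc}}(G)=1$, then $G$ is locally virtually cyclic (every finitely generated subgroup of $G$ is virtually cyclic) and $G$ is not finitely generated. -/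

import Mathlib

open Topology

universe u

/-- A group is virtually cyclic if it has a cyclic subgroup of finite index
(finite groups are included). -/
def IsVirtuallyCyclic (G : Type u) [Group G] : Prop :=
  ∃ C : Subgroup G, IsCyclic C ∧ C.FiniteIndex

/-- A group is locally virtually cyclic if all its finitely generated subgroups are
virtually cyclic. -/
def IsLocallyVirtuallyCyclic (G : Type u) [Group G] : Prop :=
  ∀ H : Subgroup G, H.FG → IsVirtuallyCyclic H

/-- A family of subgroups of `G`: a non-empty set of subgroups that is closed under
conjugation and under taking subgroups. -/
structure SubgroupFamily (G : Type u) [Group G] where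
  /-- The subgroups that belong to the family. -/
  carrier : Set (Subgroup G)
  nonempty : carrier.Nonempty
  conj_mem : ∀ H ∈ carrier, ∀ g : G, H.map (MulAut.conj g).toMonoidHom ∈ carrier
  mono : ∀ H ∈ carrier, ∀ K : Subgroup G, K ≤ H → K ∈ carrier

/-- Pull-back of virtual cyclicity along an injective homomorphism. -/
theorem IsVirtuallyCyclic.of_injective {H K : Type u} [Group H] [Group K] (f : K →* H)
    (hf : Function.Injective f) (h : IsVirtuallyCyclic H) : IsVirtuallyCyclic K := by
  obtain ⟨C, hC, hfin⟩ := h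
  refine ⟨C.comap f, ?_, ⟨by
    rw [Subgroup.index_comap]
    have := (inferInstance : (C.subgroupOf f.range).FiniteIndex).index_ne_zero
    exact this⟩⟩
  refine isCyclic_of_injective (f.subgroupComap C) ?_
  intro a b hab
  exact Subtype.ext (hf (congrArg Subtype.val hab))

/-- The family of virtually cyclic subgroups of `G`. -/
def virtuallyCyclicFamily (G : Type u) [Group G] : SubgroupFamily G where
  carrier := {H | IsVirtuallyCyclic H}
  nonempty := ⟨⊥, ⊤, inferInstance, inferInstance⟩
  conj_mem := fun H hH g =>
    IsVirtuallyCyclic.of_injective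
      (H.equivMapOfInjective _ (MulAut.conj g).injective).symm.toMonoidHom
      (H.equivMapOfInjective _ (MulAut.conj g).injective).symm.injective hH
  mono := fun _ hH _ hK =>
    IsVirtuallyCyclic.of_injective (Subgroup.inclusion hK) (Subgroup.inclusion_injective hK) hH

/-- The dimension of a CW-complex: the supremum of the dimensions of its cells. (The empty
complex gets dimension `0`; it is not a classifying space for any family.) -/
noncomputable def cwDim (X : Type u) [TopologicalSpace X] [CWComplex (Set.univ : Set X)] : ℕ∞ :=
  ⨆ (n : ℕ) (_ : Nonempty (RelCWComplex.cell (Set.univ : Set X) n)), (n : ℕ∞)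

/-- `X` is a `G`-CW-complex, for a discrete group `G`: a (Hausdorff) CW-complex on which `G`
acts by homeomorphisms such that every group element maps open cells onto open cells of the same
dimension, and a group element that maps an open cell onto itself fixes it pointwise. -/
structure IsGCWComplex (G : Type u) [Group G] (X : Type u) [TopologicalSpace X]
    [CWComplex (Set.univ : Set X)] [MulAction G X] : Prop where
  t2 : T2Space X
  continuous_smul : ∀ g : G, Continuous fun x : X => g • x
  smul_openCell : ∀ (g : G) (n : ℕ) (i : RelCWComplex.cell (Set.univ : Set X) n),
    ∃ j : RelCWComplex.cell (Set.univ : Set X) n,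
      (fun x : X => g • x) '' RelCWComplex.openCell n i = RelCWComplex.openCell n j
  smul_eq_of_stable : ∀ (g : G) (n : ℕ) (i : RelCWComplex.cell (Set.univ : Set X) n),
    (fun x : X => g • x) '' RelCWComplex.openCell n i = RelCWComplex.openCell n i →
      ∀ x ∈ RelCWComplex.openCell n i, g • x = x

/-- `X` is a classifying space of `G` for the family `F` (a model for `E_F G`). -/
structure IsClassifyingSpace {G : Type u} [Group G] (F : SubgroupFamily G) (X : Type u)
    [TopologicalSpace X] [CWComplex (Set.univ : Set X)] [MulAction G X] : Prop where
  isGCWComplex : IsGCWComplex G X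
  contractible : ∀ H ∈ F.carrier, ContractibleSpace (MulAction.fixedPoints H X)
  empty : ∀ H : Subgroup G, H ∉ F.carrier → MulAction.fixedPoints H X = ∅

/-- The geometric dimension of `G` with respect to the family `F`: the least dimension of a
classifying space of `G` for `F` (`⊤` if there is no finite dimensional one). -/
noncomputable def geometricDimension {G : Type u} [Group G] (F : SubgroupFamily G) : ℕ∞ :=
  sInf {d : ℕ∞ | ∃ (X : Type u) (_ : TopologicalSpace X) (_ : CWComplex (Set.univ : Set X))
    (_ : MulAction G X), IsClassifyingSpace F X ∧ cwDim X = d}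

/-! The value 1 is attained by some model `X` of dimension at most one. The trivial subgroup is
virtually cyclic, so `X` itself is contractible, and its 1-skeleton is a tree (`cwGraph_isTree`).
Cyclic subgroups are virtually cyclic too, so every element of `G` has a fixed point, hence a fixed
vertex. By Serre's argument a finitely generated group acting on a tree with all elements elliptic
has a global fixed vertex (`SimpleGraph.IsTree.exists_fixed_of_fg`). So `X^H` is nonempty for
finitely generated `H`, which forces `H` to be virtually cyclic. Were `G` finitely generated, every
subgroup would lie in the family and a point would be a model, giving dimension 0.

Acyclicity is obtained without homology: collapsing the complement of an open edge gives a map to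
the circle, and its lift to `ℝ` changes by 1 along that edge but is constant along every other edge,
so each edge is a bridge. -/

/-! ### Fixed vertices of groups acting on trees -/

/-- In an acyclic graph, a path from `p` whose second vertex is moved by an injective endomorphism
`φ` fixing `p` unfolds to a path through `p` from its endpoint to the image of its endpoint. -/
theorem SimpleGraph.IsAcyclic.exists_isPath_unfold {V : Type*} {T : SimpleGraph V}
    (hT : T.IsAcyclic) (φ : T →g T) (hφ : Function.Injective φ) {p q : V} (P : T.Walk p q)
    (hP : P.IsPath) (hp : φ p = p) (hn : ¬ P.Nil) (hs : φ P.snd ≠ P.snd) :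
    ∃ W : T.Walk q (φ q), W.IsPath ∧ W.length = 2 * P.length ∧ W.getVert P.length = p := by
  refine ⟨P.reverse.append ((P.map φ).copy hp rfl), ?_, ?_, ?_⟩
  -- In an acyclic graph a walk without backtracking is a path. Only the turn at `p` has to be
  -- checked, and there `hs` applies.
  · rw [hT.isPath_iff_isChain]
    have h1 := (hT.isPath_iff_isChain _).1 hP.reverse
    have h2 := (hT.isPath_iff_isChain _).1 (hP.map hφ)
    rw [SimpleGraph.Walk.edges_append, SimpleGraph.Walk.edges_copy, List.isChain_append]
    refine ⟨h1, h2, ?_⟩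
    cases P with
    | nil => simp at hn
    | cons h P' =>
      simp at hs ⊢
      grind
  · simp; omega
  · rw [SimpleGraph.Walk.getVert_append]
    simp

/-- In a connected graph, a path from a vertex with property `Q` that is closest to `q` leaves the
vertices with property `Q` at once. -/
theorem SimpleGraph.Connected.exists_isPath_snd {V : Type*} {T : SimpleGraph V}
    (hT : T.Connected) (Q : V → Prop) (hQ : ∃ v, Q v) (q : V) :
    ∃ p, Q p ∧ ∃ P : T.Walk p q, P.IsPath ∧ (¬ P.Nil → ¬ Q P.snd) := by
  obtain ⟨p, hp, hmin⟩ := exists_minimalFor_of_wellFoundedLT Q (fun v => T.dist v q) hQ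
  obtain ⟨P, hP, hl⟩ := (hT p q).exists_path_of_dist
  refine ⟨p, hp, P, hP, fun hn hQs => ?_⟩
  have h1 : T.dist P.snd q ≤ P.tail.length := SimpleGraph.dist_le _
  have h2 := SimpleGraph.Walk.length_tail_add_one hn
  have h3 : T.dist p q ≤ T.dist P.snd q := hmin hQs (by simp only; omega)
  omega

section Tree

variable {G : Type*} [Group G] {V : Type*} [MulAction G V] {T : SimpleGraph V}

/-- If `A` and `s` both have fixed vertices in a tree and all group elements have fixed
vertices, then `A` and `s` have a common fixed vertex. -/
theorem SimpleGraph.IsTree.exists_common_fixed (hT : T.IsTree)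
    (hadj : ∀ (g : G) (u v : V), T.Adj u v → T.Adj (g • u) (g • v))
    (hell : ∀ g : G, ∃ v : V, g • v = v) (A : Subgroup G) (s : G)
    (hA : ∃ v : V, ∀ a ∈ A, a • v = v) :
    ∃ v : V, (∀ a ∈ A, a • v = v) ∧ s • v = v := by
  let φ : G → (T →g T) := fun g => ⟨fun v => g • v, fun {u v} h => hadj g u v h⟩
  have hφ : ∀ g, Function.Injective (φ g) := fun g => MulAction.injective g
  obtain ⟨q, hq⟩ := hell s
  obtain ⟨p, hp, P, hP, hPs⟩ :=
    hT.connected.exists_isPath_snd (fun v => ∀ a ∈ A, a • v = v) hA q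
  refine ⟨p, hp, ?_⟩
  by_cases hPn : P.Nil
  · rw [hPn.eq, hq]
  obtain ⟨a, ha, hay⟩ : ∃ a ∈ A, a • P.snd ≠ P.snd := by simpa using hPs hPn
  obtain ⟨W, hW, hWl, hWp⟩ := hT.isAcyclic.exists_isPath_unfold (φ a) (hφ a) P hP (hp a ha) hPn hay
  obtain ⟨v, hv, R, hR, hRs⟩ :=
    hT.connected.exists_isPath_snd (fun v => (a * s) • v = v) (hell (a * s)) q
  have hgq : φ a q = φ (a * s) q := by
    change a • q = (a * s) • q
    rw [mul_smul, hq]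
  have hPl : 0 < P.length := SimpleGraph.Walk.not_nil_iff_lt_length.1 hPn
  -- As `s` fixes `q`, both `a` and `a * s` send `q` to the same vertex. Unfolding `P` by `a` and
  -- `R` by `a * s` therefore gives the same path, by uniqueness in a tree; its midpoint is both `p`
  -- and `v`.
  have key : v = p := by
    by_cases hRn : R.Nil
    · have hvq : v = q := hRn.eq
      subst hvq
      -- Here `a` fixes `q`, so `W` is a closed path, contradicting its positive length.
      have h1 : v = φ a v := (hgq.trans hv).symm
      have h2 := SimpleGraph.Walk.isPath_iff_nil.1
        ((SimpleGraph.Walk.isPath_copy W rfl h1.symm).2 hW)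
      rw [← SimpleGraph.Walk.length_eq_zero_iff, SimpleGraph.Walk.length_copy] at h2
      omega
    · obtain ⟨W', hW', hWl', hWp'⟩ :=
        hT.isAcyclic.exists_isPath_unfold (φ (a * s)) (hφ _) R hR hv hRn (hRs hRn)
      have h1 : W.copy rfl hgq = W' :=
        (hT.existsUnique_path _ _).unique (by simpa using hW) hW'
      have h2 := congrArg SimpleGraph.Walk.length h1
      rw [SimpleGraph.Walk.length_copy, hWl, hWl'] at h2
      have h3 : P.length = R.length := by omega
      rw [← hWp, ← hWp', ← h1, h3]
      simp
  subst key
  have h4 : a • s • v = a • v := by rw [← mul_smul, hv, hp a ha]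
  exact MulAction.injective a h4

/-- A finitely generated group of automorphisms of a tree all of whose elements fix a vertex
has a common fixed vertex. -/
theorem SimpleGraph.IsTree.exists_fixed_of_fg (hT : T.IsTree)
    (hadj : ∀ (g : G) (u v : V), T.Adj u v → T.Adj (g • u) (g • v))
    (hell : ∀ g : G, ∃ v : V, g • v = v) (H : Subgroup G) (hH : H.FG) :
    ∃ v : V, ∀ h ∈ H, h • v = v := by
  classical
  obtain ⟨S, rfl⟩ := hH
  induction S using Finset.induction_on with
  | empty =>
    obtain ⟨v, -⟩ := hell 1
    exact ⟨v, by simp⟩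
  | insert s S _ ih =>
    obtain ⟨v, hv, hs⟩ := hT.exists_common_fixed hadj hell _ s ih
    refine ⟨v, fun h hh => ?_⟩
    have hle : Subgroup.closure ((insert s S : Finset G) : Set G) ≤ MulAction.stabilizer G v := by
      rw [Subgroup.closure_le]
      intro x hx
      rcases Finset.mem_insert.1 hx with rfl | hx
      · exact hs
      · exact hv x (Subgroup.subset_closure hx)
    exact hle hh

end Tree

/-! ### Lifting along `ℝ → ℝ / ℤ` -/

section Covering

/-- A continuous map from a contractible space to the circle `ℝ / ℤ` lifts to `ℝ`. -/
theorem ContractibleSpace.exists_lift_addCircle {X : Type*} [TopologicalSpace X]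
    [ContractibleSpace X] (f : C(X, AddCircle (1 : ℝ))) :
    ∃ F : C(X, ℝ), ∀ x, (F x : AddCircle (1 : ℝ)) = f x := by
  obtain ⟨y, hy⟩ := id_nullhomotopic X
  obtain ⟨H⟩ := ((ContinuousMap.Homotopic.refl f).comp hy).symm
  obtain ⟨r, hr⟩ := QuotientAddGroup.mk_surjective (f y)
  have h0 : ∀ x, H.toContinuousMap (0, x) =
      ((ContinuousMap.const X r x : ℝ) : AddCircle (1 : ℝ)) := fun x => by
    refine (H.apply_zero x).trans ?_
    exact hr.symm
  let cov := AddCircle.isCoveringMap_coe (𝕜 := ℝ) (1 : ℝ)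
  -- The homotopy runs from a constant map, which lifts, to `f`; the lift of `f` is the time 1 end
  -- of the lifted homotopy.
  let L := cov.liftHomotopy H.toContinuousMap (ContinuousMap.const X r) h0
  refine ⟨L.comp ((ContinuousMap.const X 1).prodMk (ContinuousMap.id X)), fun x => ?_⟩
  have h1 := congrFun (cov.liftHomotopy_lifts H.toContinuousMap (ContinuousMap.const X r) h0) (1, x)
  exact h1.trans (H.apply_one x)

/-- A continuous real function with values in `ℤ` is constant on preconnected sets. -/
theorem IsPreconnected.eq_of_coe_addCircle_eq_zero {Y : Type*} [TopologicalSpace Y] {s : Set Y}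
    (hs : IsPreconnected s) {h : Y → ℝ} (hc : ContinuousOn h s)
    (h0 : ∀ y ∈ s, (h y : AddCircle (1 : ℝ)) = 0) {x y : Y} (hx : x ∈ s) (hy : y ∈ s) :
    h x = h y := by
  have hd : IsDiscrete (Set.range ((↑) : ℤ → ℝ)) :=
    Int.isClosedEmbedding_coe_real.isEmbedding.isDiscrete_range
  refine hs.constant_of_mapsTo hd hc (fun z hz => ?_) hx hy
  obtain ⟨n, hn⟩ := (AddCircle.coe_eq_zero_iff (1 : ℝ)).1 (h0 z hz)
  exact ⟨n, by simpa using hn⟩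

end Covering

/-! ### Edges of one-dimensional complexes -/

section OneDimensional

open RelCWComplex Metric

variable {X : Type u} [TopologicalSpace X] [CWComplex (Set.univ : Set X)]

theorem Topology.CWComplex.disjoint_cellFrontier_one_openCell (e : cell (Set.univ : Set X) 1)
    (f : cell (Set.univ : Set X) 1) : Disjoint (cellFrontier 1 e) (openCell 1 f) := by
  obtain ⟨x, y, h⟩ := CWComplex.exists_cellFrontier_one_eq e
  rw [h, closedCell_zero_eq_singleton, closedCell_zero_eq_singleton,
    ← openCell_zero_eq_singleton, ← openCell_zero_eq_singleton, Set.disjoint_union_left]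
  exact ⟨disjoint_openCell_of_ne (by simp), disjoint_openCell_of_ne (by simp)⟩

theorem Topology.CWComplex.disjoint_closedCell_one_openCell {e f : cell (Set.univ : Set X) 1}
    (hef : e ≠ f) : Disjoint (closedCell 1 e) (openCell 1 f) := by
  rw [← cellFrontier_union_openCell_eq_closedCell, Set.disjoint_union_left]
  exact ⟨CWComplex.disjoint_cellFrontier_one_openCell e f, disjoint_openCell_of_ne (by simpa)⟩

/-- In dimension at most one, a set is closed if its traces on vertices and edges are closed. -/
theorem Topology.CWComplex.isClosed_of_one_dimensional [T2Space X]
    (hdim : ∀ n, 2 ≤ n → IsEmpty (cell (Set.univ : Set X) n)) {A : Set X}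
    (hA : ∀ e : cell (Set.univ : Set X) 1, IsClosed (A ∩ closedCell 1 e)) : IsClosed A := by
  refine CWComplex.isClosed_of_disjoint_openCell_or_isClosed_inter_closedCell
    (C := (Set.univ : Set X)) (Set.subset_univ _) fun n hn j => Or.inr ?_
  obtain rfl | hn2 : n = 1 ∨ 2 ≤ n := by omega
  · exact hA j
  · exact ((hdim n hn2).false j).elim

open Classical in
/-- The map that collapses the complement of the open edge `e` to a point, as a map to `ℝ / ℤ`. -/
noncomputable def edgeCollapse (e : cell (Set.univ : Set X) 1) (x : X) : AddCircle (1 : ℝ) :=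
  if x ∈ openCell 1 e then ((((map 1 e).symm x 0 + 1) / 2 : ℝ) : AddCircle (1 : ℝ)) else 0

theorem edgeCollapse_of_notMem {e : cell (Set.univ : Set X) 1} {x : X} (hx : x ∉ openCell 1 e) :
    edgeCollapse e x = 0 := if_neg hx

/-- The formula extends to the ends of the edge because `t 0 = -1` and `t 0 = 1` give 0 and 1, which
agree in `ℝ / ℤ`. -/
theorem edgeCollapse_map (e : cell (Set.univ : Set X) 1) {t : Fin 1 → ℝ}
    (ht : t ∈ closedBall 0 1) :
    edgeCollapse e (map 1 e t) = (((t 0 + 1) / 2 : ℝ) : AddCircle (1 : ℝ)) := by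
  rcases (mem_closedBall.1 ht).lt_or_eq with h | h
  · have hb : t ∈ ball (0 : Fin 1 → ℝ) 1 := h
    rw [edgeCollapse, if_pos (show map 1 e t ∈ openCell 1 e from ⟨t, hb, rfl⟩),
      (map 1 e).left_inv (by rwa [source_eq])]
  · have hf : map 1 e t ∈ cellFrontier 1 e := Set.mem_image_of_mem _ h
    rw [edgeCollapse_of_notMem
      (Set.disjoint_left.1 (CWComplex.disjoint_cellFrontier_one_openCell e e) hf)]
    have h1 : |t 0| = 1 := by
      simpa [Pi.norm_def] using h
    rcases eq_or_eq_neg_of_abs_eq h1 with h2 | h2 <;> rw [h2]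
    · norm_num [AddCircle.coe_period]
    · norm_num

/-- Closedness is tested edge by edge: on `e` the preimage is the image of a compact set under the
characteristic map, and on any other closed edge the map is constantly 0. -/
theorem continuous_edgeCollapse [T2Space X]
    (hdim : ∀ n, 2 ≤ n → IsEmpty (cell (Set.univ : Set X) n)) (e : cell (Set.univ : Set X) 1) :
    Continuous (edgeCollapse e) := by
  rw [continuous_iff_isClosed]
  intro C hC
  refine CWComplex.isClosed_of_one_dimensional hdim fun f => ?_
  by_cases hfe : f = e
  · subst hfe
    have h1 : edgeCollapse f ⁻¹' C ∩ closedCell 1 f = map 1 f '' (closedBall 0 1 ∩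
        (fun t : Fin 1 → ℝ => (((t 0 + 1) / 2 : ℝ) : AddCircle (1 : ℝ))) ⁻¹' C) := by
      ext x
      constructor
      · rintro ⟨hx, t, ht, rfl⟩
        exact ⟨t, ⟨ht, by simpa [edgeCollapse_map f ht] using hx⟩, rfl⟩
      · rintro ⟨t, ⟨ht, htC⟩, rfl⟩
        exact ⟨by simpa [edgeCollapse_map f ht] using htC, t, ht, rfl⟩
    rw [h1]
    refine IsCompact.isClosed (((isCompact_closedBall _ _).inter_right
      (hC.preimage ?_)).image_of_continuousOn ((continuousOn 1 f).mono Set.inter_subset_left))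
    exact (AddCircle.continuous_mk' _).comp (by fun_prop)
  · have h0 : ∀ x ∈ closedCell 1 f, edgeCollapse e x = 0 := fun x hx =>
      edgeCollapse_of_notMem (Set.disjoint_left.1 (CWComplex.disjoint_closedCell_one_openCell hfe) hx)
    by_cases hC0 : (0 : AddCircle (1 : ℝ)) ∈ C
    · rw [Set.inter_eq_right.2 fun x hx => by simpa [h0 x hx] using hC0]
      exact isClosed_closedCell
    · have : edgeCollapse e ⁻¹' C ∩ closedCell 1 f = ∅ := by
        ext x
        simp only [Set.mem_inter_iff, Set.mem_preimage, Set.mem_empty_iff_false, iff_false, not_and]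
        intro hx hxf
        exact hC0 (h0 x hxf ▸ hx)
      rw [this]
      exact isClosed_empty

/-- Every edge of a contractible one-dimensional complex separates its endpoints: there is a real
function that is constant on connected sets missing the edge but not on the ends of the edge. -/
theorem exists_separating_edge [T2Space X] [ContractibleSpace X]
    (hdim : ∀ n, 2 ≤ n → IsEmpty (cell (Set.univ : Set X) n)) (e : cell (Set.univ : Set X) 1) :
    ∃ F : X → ℝ, (∀ S : Set X, IsPreconnected S → Disjoint S (openCell 1 e) →
      ∀ x ∈ S, ∀ y ∈ S, F x = F y) ∧ F (map 1 e (-1)) ≠ F (map 1 e 1) := by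
  obtain ⟨F, hF⟩ := ContractibleSpace.exists_lift_addCircle
    ⟨edgeCollapse e, continuous_edgeCollapse hdim e⟩
  refine ⟨F, fun S hS hd x hx y hy => ?_, fun heq => ?_⟩
  · refine hS.eq_of_coe_addCircle_eq_zero F.continuous.continuousOn (fun z hz => ?_) hx hy
    exact (hF z).trans (edgeCollapse_of_notMem (Set.disjoint_left.1 hd hz))
  · have hpre : IsPreconnected (closedBall (0 : Fin 1 → ℝ) 1) :=
      (convex_closedBall _ _).isPreconnected
    -- Along `e` the lift differs from `(t 0 + 1) / 2` by an integer, constant by connectedness; so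
    -- `F` grows by 1 from one end to the other.
    have := hpre.eq_of_coe_addCircle_eq_zero
      (h := fun t : Fin 1 → ℝ => F (map 1 e t) - (t 0 + 1) / 2) (x := -1) (y := 1)
      ((F.continuous.comp_continuousOn (continuousOn 1 e)).sub (by fun_prop))
      (fun t ht => by
        rw [AddCircle.coe_sub, hF]
        exact sub_eq_zero.2 (edgeCollapse_map e ht))
      (by simp) (by simp)
    norm_num [heq] at this
    linarith

end OneDimensional

/-! ### The 1-skeleton as a tree -/

section Skeleton

open RelCWComplex Metric

variable (X : Type u) [TopologicalSpace X] [CWComplex (Set.univ : Set X)]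

/-- The vertices of a CW-complex, as points. -/
def cwVertices : Set X := {x | ∃ i : cell (Set.univ : Set X) 0, x ∈ openCell 0 i}

/-- The simple graph underlying the `1`-skeleton of a CW-complex. -/
def cwGraph : SimpleGraph (cwVertices X) where
  Adj u v := u ≠ v ∧ ∃ e : cell (Set.univ : Set X) 1, cellFrontier 1 e = {(u : X), (v : X)}
  symm := ⟨fun u v ⟨h, e, he⟩ => ⟨h.symm, e, by rw [he, Set.pair_comm]⟩⟩
  loopless := ⟨fun _ h => h.1 rfl⟩

variable {X}

theorem cellFrontier_one_subset_cwVertices (e : cell (Set.univ : Set X) 1) :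
    cellFrontier 1 e ⊆ cwVertices X := by
  obtain ⟨x, y, h⟩ := CWComplex.exists_cellFrontier_one_eq e
  rw [h, closedCell_zero_eq_singleton, closedCell_zero_eq_singleton,
    ← openCell_zero_eq_singleton, ← openCell_zero_eq_singleton]
  rintro z (hz | hz)
  exacts [⟨x, hz⟩, ⟨y, hz⟩]

theorem mem_cellFrontier_of_mem_cwVertices {e : cell (Set.univ : Set X) 1} {x : X}
    (hx : x ∈ cwVertices X) (hxe : x ∈ closedCell 1 e) : x ∈ cellFrontier 1 e := by
  rw [← cellFrontier_union_openCell_eq_closedCell] at hxe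
  refine hxe.resolve_right fun h => ?_
  obtain ⟨i, hi⟩ := hx
  exact Set.disjoint_left.1 (disjoint_openCell_of_ne (by simp)) hi h

theorem cellFrontier_one_eq_pair (e : cell (Set.univ : Set X) 1) :
    cellFrontier 1 e = {map 1 e (-1), map 1 e 1} := by
  rw [cellFrontier_one_eq, Set.image_pair]

theorem cwGraph_reachable_of_mem_cellFrontier {e : cell (Set.univ : Set X) 1}
    {u v : cwVertices X} (hu : (u : X) ∈ cellFrontier 1 e) (hv : (v : X) ∈ cellFrontier 1 e) :
    (cwGraph X).Reachable u v := by
  by_cases huv : u = v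
  · rw [huv]
  · have huv' : (u : X) ≠ v := fun h => huv (Subtype.ext h)
    refine SimpleGraph.Adj.reachable ⟨huv, e, ?_⟩
    rw [cellFrontier_one_eq_pair] at hu hv ⊢
    rcases hu with hu | hu <;> rcases hv with hv | hv
    · exact (huv' (hu.trans hv.symm)).elim
    · rw [hu, hv]
    · rw [hu, hv, Set.pair_comm]
    · exact (huv' (hu.trans hv.symm)).elim

theorem mem_cwVertices_or_mem_openCell_one
    (hdim : ∀ n, 2 ≤ n → IsEmpty (cell (Set.univ : Set X) n)) (x : X) :
    x ∈ cwVertices X ∨ ∃ e : cell (Set.univ : Set X) 1, x ∈ openCell 1 e := by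
  have hx : x ∈ ⋃ (n : ℕ) (j : cell (Set.univ : Set X) n), openCell n j := by
    rw [CWComplex.iUnion_openCell_eq_complex]
    trivial
  simp only [Set.mem_iUnion] at hx
  obtain ⟨n, j, hj⟩ := hx
  obtain rfl | rfl | hn2 : n = 0 ∨ n = 1 ∨ 2 ≤ n := by omega
  · exact Or.inl ⟨j, hj⟩
  · exact Or.inr ⟨j, hj⟩
  · exact ((hdim n hn2).false j).elim

/-- The component of `u`, together with all closed edges touching it, contains or misses each closed
edge. It is therefore clopen, hence everything. -/
theorem cwGraph_connected [T2Space X] [ConnectedSpace X]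
    (hdim : ∀ n, 2 ≤ n → IsEmpty (cell (Set.univ : Set X) n)) : (cwGraph X).Connected := by
  have hne : Nonempty (cwVertices X) := by
    obtain ⟨x⟩ : Nonempty X := inferInstance
    rcases mem_cwVertices_or_mem_openCell_one hdim x with hx | ⟨e, -⟩
    · exact ⟨⟨x, hx⟩⟩
    · exact ⟨⟨map 1 e 1, cellFrontier_one_subset_cwVertices e (by simp [cellFrontier_one_eq_pair])⟩⟩
  refine ⟨fun u w => ?_⟩
  let S : Set X := {x | ∃ v : cwVertices X, (cwGraph X).Reachable u v ∧
    (x = v ∨ ∃ e : cell (Set.univ : Set X) 1, (v : X) ∈ cellFrontier 1 e ∧ x ∈ closedCell 1 e)}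
  have hS : ∀ e : cell (Set.univ : Set X) 1, closedCell 1 e ⊆ S ∨ Disjoint S (closedCell 1 e) := by
    intro e
    by_cases h : ∃ x ∈ S, x ∈ closedCell 1 e
    · refine Or.inl ?_
      suffices h' : ∃ v : cwVertices X, (cwGraph X).Reachable u v ∧ (v : X) ∈ cellFrontier 1 e by
        obtain ⟨v, hv, hve⟩ := h'
        exact fun y hy => ⟨v, hv, Or.inr ⟨e, hve, hy⟩⟩
      obtain ⟨x, ⟨v, hv, hxv⟩, hxe⟩ := h
      rcases hxv with rfl | ⟨f, hvf, hxf⟩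
      · exact ⟨v, hv, mem_cellFrontier_of_mem_cwVertices v.2 hxe⟩
      · by_cases hef : e = f
        · exact ⟨v, hv, hef ▸ hvf⟩
        · rw [← cellFrontier_union_openCell_eq_closedCell] at hxe
          have hxe' := hxe.resolve_right
            (Set.disjoint_left.1 (CWComplex.disjoint_closedCell_one_openCell (Ne.symm hef)) hxf)
          have hx := cellFrontier_one_subset_cwVertices e hxe'
          exact ⟨⟨x, hx⟩, hv.trans (cwGraph_reachable_of_mem_cellFrontier hvf
            (mem_cellFrontier_of_mem_cwVertices hx hxf)), hxe'⟩
    · exact Or.inr (Set.disjoint_left.2 fun x hx hxe => h ⟨x, hx, hxe⟩)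
  have hclopen : IsClopen S := by
    refine ⟨CWComplex.isClosed_of_one_dimensional hdim fun e => ?_,
      isClosed_compl_iff.1 (CWComplex.isClosed_of_one_dimensional hdim fun e => ?_)⟩
    · rcases hS e with h | h
      · rw [Set.inter_eq_right.2 h]
        exact isClosed_closedCell
      · rw [h.inter_eq]
        exact isClosed_empty
    · rcases hS e with h | h
      · rw [(Set.disjoint_compl_left_iff_subset.2 h).inter_eq]
        exact isClosed_empty
      · rw [Set.inter_eq_right.2 (Set.subset_compl_iff_disjoint_left.2 h)]
        exact isClosed_closedCell
  have hw : (w : X) ∈ S := by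
    rw [hclopen.eq_univ ⟨u, u, SimpleGraph.Reachable.refl u, Or.inl rfl⟩]
    trivial
  obtain ⟨v, hv, hwv | ⟨e, hve, hwe⟩⟩ := hw
  · rwa [Subtype.ext hwv]
  · exact hv.trans (cwGraph_reachable_of_mem_cellFrontier hve
      (mem_cellFrontier_of_mem_cwVertices w.2 hwe))

theorem isPreconnected_closedCell {n : ℕ} (i : cell (Set.univ : Set X) n) :
    IsPreconnected (closedCell n i) :=
  (convex_closedBall (0 : Fin n → ℝ) 1).isPreconnected.image _ (continuousOn n i)

/-- Each edge is a bridge: the function separating its ends is constant along walks that avoid it.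
-/
theorem cwGraph_isAcyclic [T2Space X] [ContractibleSpace X]
    (hdim : ∀ n, 2 ≤ n → IsEmpty (cell (Set.univ : Set X) n)) : (cwGraph X).IsAcyclic := by
  rw [SimpleGraph.isAcyclic_iff_forall_adj_isBridge]
  rintro u v ⟨huv, e, he⟩
  obtain ⟨F, hF, hFe⟩ := exists_separating_edge hdim e
  have hFuv : F u ≠ F v := by
    have h := he.symm.trans (cellFrontier_one_eq_pair e)
    rcases Set.pair_eq_pair_iff.1 h with ⟨h1, h2⟩ | ⟨h1, h2⟩ <;> rw [h1, h2]
    exacts [hFe, hFe.symm]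
  rw [SimpleGraph.isBridge_iff]
  rintro ⟨p⟩
  have hwalk : ∀ {x y : cwVertices X}, ((cwGraph X).deleteEdges {s(u, v)}).Walk x y →
      F x = F y := by
    intro x y q
    induction q with
    | nil => rfl
    | @cons x y z h q ih =>
      refine Eq.trans ?_ ih
      rw [SimpleGraph.deleteEdges_adj] at h
      obtain ⟨⟨-, f, hf⟩, hne⟩ := h
      -- Deleting `s(u, v)` removes every cell with ends `u` and `v`, in particular `e`.
      have hfe : f ≠ e := by
        rintro rfl
        refine hne (Sym2.eq_iff.2 ?_)
        simpa [Set.pair_eq_pair_iff, Subtype.ext_iff] using hf.symm.trans he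
      exact hF _ (isPreconnected_closedCell f) (CWComplex.disjoint_closedCell_one_openCell hfe)
        _ (cellFrontier_subset_closedCell 1 f (by simp [hf]))
        _ (cellFrontier_subset_closedCell 1 f (by simp [hf]))
  exact hFuv (hwalk p)

theorem cwGraph_isTree [T2Space X] [ContractibleSpace X]
    (hdim : ∀ n, 2 ≤ n → IsEmpty (cell (Set.univ : Set X) n)) : (cwGraph X).IsTree :=
  ⟨cwGraph_connected hdim, cwGraph_isAcyclic hdim⟩

end Skeleton

/-! ### The induced action on the tree -/

section Action

open RelCWComplex

variable {G : Type u} [Group G] {X : Type u} [TopologicalSpace X]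
  [CWComplex (Set.univ : Set X)] [MulAction G X]

/-- The vertices of a `G`-CW-complex as an invariant subset. -/
def IsGCWComplex.vertices (hX : IsGCWComplex G X) : SubMulAction G X where
  carrier := cwVertices X
  smul_mem' g x := by
    rintro ⟨i, hi⟩
    obtain ⟨j, hj⟩ := hX.smul_openCell g 0 i
    exact ⟨j, hj ▸ Set.mem_image_of_mem _ hi⟩

/-- Homeomorphisms respect closures, and in dimension one the frontier is exactly the closed cell
minus the open cell. This makes the action preserve adjacency in `cwGraph X`. -/
theorem IsGCWComplex.smul_cellFrontier_one (hX : IsGCWComplex G X) (g : G)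
    (e : cell (Set.univ : Set X) 1) :
    ∃ f : cell (Set.univ : Set X) 1, (fun x : X => g • x) '' cellFrontier 1 e = cellFrontier 1 f := by
  have := hX.t2
  have : ContinuousConstSMul G X := ⟨hX.continuous_smul⟩
  obtain ⟨f, hf⟩ := hX.smul_openCell g 1 e
  have hc : (fun x : X => g • x) '' closedCell 1 e = closedCell 1 f := by
    rw [← closure_openCell_eq_closedCell, ← closure_openCell_eq_closedCell, ← hf]
    exact (Homeomorph.smul g).image_closure _
  have hdiff : ∀ e : cell (Set.univ : Set X) 1,
      cellFrontier 1 e = closedCell 1 e \ openCell 1 e := fun e => by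
    rw [← cellFrontier_union_openCell_eq_closedCell, Set.union_sdiff_right,
      (CWComplex.disjoint_cellFrontier_one_openCell e e).sdiff_eq_left]
  exact ⟨f, by rw [hdiff, hdiff, Set.image_sdiff (MulAction.injective g), hc, hf]⟩

/-- In a `G`-CW-complex of dimension at most one, a subgroup with a fixed point fixes a vertex. -/
theorem IsGCWComplex.exists_fixed_vertex (hX : IsGCWComplex G X)
    (hdim : ∀ n, 2 ≤ n → IsEmpty (cell (Set.univ : Set X) n)) (H : Subgroup G) {x : X}
    (hx : ∀ h ∈ H, h • x = x) : ∃ v ∈ cwVertices X, ∀ h ∈ H, h • v = v := by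
  have := hX.t2
  rcases mem_cwVertices_or_mem_openCell_one hdim x with hxv | ⟨e, he⟩
  · exact ⟨x, hxv, hx⟩
  have hv : map 1 e 1 ∈ cellFrontier 1 e := by simp [cellFrontier_one_eq_pair]
  refine ⟨map 1 e 1, cellFrontier_one_subset_cwVertices e hv, fun h hh => ?_⟩
  obtain ⟨f, hf⟩ := hX.smul_openCell h 1 e
  -- Since `h` fixes a point of the open edge, it stabilizes the edge and so fixes it pointwise; the
  -- ends follow by taking closures.
  have hfe : f = e := by
    have hxf : x ∈ openCell 1 f := by
      rw [← hf]
      exact ⟨x, he, hx h hh⟩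
    simpa using eq_of_not_disjoint_openCell (Set.not_disjoint_iff.2 ⟨x, hxf, he⟩)
  have hclosed : IsClosed {y : X | h • y = y} :=
    isClosed_eq (hX.continuous_smul h) continuous_id
  have hsub : closedCell 1 e ⊆ {y : X | h • y = y} := by
    rw [← closure_openCell_eq_closedCell]
    exact closure_minimal (hX.smul_eq_of_stable h 1 e (hfe ▸ hf)) hclosed
  exact hsub (cellFrontier_subset_closedCell 1 e hv)

/-- If `G` acts on a contractible `G`-CW-complex of dimension at most one such that each element
has a fixed point, then all finitely generated subgroups have fixed points. -/
theorem IsGCWComplex.exists_fixed_of_fg [ContractibleSpace X] (hX : IsGCWComplex G X)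
    (hdim : ∀ n, 2 ≤ n → IsEmpty (cell (Set.univ : Set X) n))
    (hell : ∀ g : G, ∃ x : X, g • x = x) (H : Subgroup G) (hH : H.FG) :
    ∃ x : X, ∀ h ∈ H, h • x = x := by
  have := hX.t2
  have hadj : ∀ (g : G) (u v : hX.vertices), (cwGraph X).Adj u v →
      (cwGraph X).Adj (g • u : hX.vertices) (g • v : hX.vertices) := by
    rintro g u v ⟨huv, e, he⟩
    obtain ⟨f, hf⟩ := hX.smul_cellFrontier_one g e
    refine ⟨fun h => huv (MulAction.injective (β := hX.vertices) g h), f, ?_⟩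
    rw [← hf, he, Set.image_pair]
    rfl
  have hell' : ∀ g : G, ∃ v : hX.vertices, g • v = v := fun g => by
    obtain ⟨x, hx⟩ := hell g
    obtain ⟨v, hv, hgv⟩ := hX.exists_fixed_vertex hdim (Subgroup.zpowers g) (x := x) (by
      have : Subgroup.zpowers g ≤ MulAction.stabilizer G x := by simpa using hx
      exact fun h hh => this hh)
    exact ⟨⟨v, hv⟩, Subtype.ext (hgv g (Subgroup.mem_zpowers g))⟩
  obtain ⟨v, hv⟩ := SimpleGraph.IsTree.exists_fixed_of_fg (V := hX.vertices)
    (cwGraph_isTree hdim) hadj hell' H hH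
  exact ⟨v, fun h hh => congrArg Subtype.val (hv h hh)⟩

end Action

/-! ### Dimension counts and the conclusion -/

theorem isEmpty_cell_of_cwDim_le {X : Type u} [TopologicalSpace X] [CWComplex (Set.univ : Set X)]
    {d : ℕ} (hd : cwDim X ≤ d) (n : ℕ) (hn : d < n) :
    IsEmpty (RelCWComplex.cell (Set.univ : Set X) n) := by
  by_contra h
  rw [not_isEmpty_iff] at h
  have h1 : (n : ℕ∞) ≤ cwDim X :=
    le_iSup₂ (f := fun (n : ℕ) (_ : Nonempty (RelCWComplex.cell (Set.univ : Set X) n)) => (n : ℕ∞))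
      n h
  exact absurd (h1.trans hd) (by simpa using hn)

theorem cwDim_punit : cwDim PUnit.{u + 1} = 0 := by
  refine le_antisymm (iSup₂_le fun n hn => ?_) bot_le
  obtain ⟨i⟩ := hn
  cases n with
  | zero => simp
  | succ n => exact i.elim

/-- A point is a classifying space for every family that contains all subgroups. -/
theorem geometricDimension_eq_zero {G : Type u} [Group G] (F : SubgroupFamily G)
    (hF : ∀ H : Subgroup G, H ∈ F.carrier) : geometricDimension F = 0 := by
  refine le_antisymm (sInf_le ?_) bot_le
  let act : MulAction G PUnit.{u + 1} :=
    { smul := fun _ x => x, one_smul := fun _ => rfl, mul_smul := fun _ _ _ => rfl }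
  refine ⟨PUnit, inferInstance, inferInstance, act, ⟨⟨inferInstance, fun _ => continuous_id,
    fun g n i => ⟨i, ?_⟩, fun _ _ _ _ _ _ => rfl⟩, fun H _ => ?_, fun H hH => (hH (hF H)).elim⟩,
    cwDim_punit⟩
  · exact Set.image_id _
  · have hu : MulAction.fixedPoints H PUnit.{u + 1} = Set.univ := Set.eq_univ_of_forall fun _ _ => rfl
    rw [hu]
    exact (Homeomorph.Set.univ PUnit.{u + 1}).contractibleSpace

theorem isVirtuallyCyclic_of_isCyclic (G : Type u) [Group G] [IsCyclic G] : IsVirtuallyCyclic G :=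
  ⟨⊤, inferInstance, inferInstance⟩

theorem mainTheorem4 {G : Type u} [Group G]
    (hG : geometricDimension (virtuallyCyclicFamily G) = 1) :
    IsLocallyVirtuallyCyclic G ∧ ¬ Group.FG G := by
  have hloc : IsLocallyVirtuallyCyclic G := by
    -- With no model at all the infimum would be `⊤`; being nonempty, the set contains its infimum
    -- 1.
    have hne : {d : ℕ∞ | ∃ (X : Type u) (_ : TopologicalSpace X)
        (_ : CWComplex (Set.univ : Set X)) (_ : MulAction G X),
        IsClassifyingSpace (virtuallyCyclicFamily G) X ∧ cwDim X = d}.Nonempty := by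
      rw [Set.nonempty_iff_ne_empty]
      intro h
      rw [geometricDimension, h, sInf_empty] at hG
      exact absurd hG (by simp)
    obtain ⟨X, _, _, _, hX, hd⟩ := csInf_mem hne
    have hd1 : cwDim X ≤ (1 : ℕ) := by
      rw [hd]
      exact hG.le
    have hdim := isEmpty_cell_of_cwDim_le hd1
    have hcyc : ∀ g : G, Subgroup.zpowers g ∈ (virtuallyCyclicFamily G).carrier :=
      fun g => isVirtuallyCyclic_of_isCyclic _
    have hbot : MulAction.fixedPoints (⊥ : Subgroup G) X = Set.univ := by
      ext x
      simp [MulAction.mem_fixedPoints]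
    have hc : ContractibleSpace X := by
      have h := hX.contractible ⊥ (isVirtuallyCyclic_of_isCyclic _)
      rw [hbot] at h
      exact (Homeomorph.Set.univ X).symm.contractibleSpace
    have hell : ∀ g : G, ∃ x : X, g • x = x := fun g => by
      have h := hX.contractible _ (hcyc g)
      obtain ⟨x, hx⟩ : Nonempty (MulAction.fixedPoints (Subgroup.zpowers g) X) := inferInstance
      exact ⟨x, hx ⟨g, Subgroup.mem_zpowers g⟩⟩
    intro H hH
    obtain ⟨x, hx⟩ := hX.isGCWComplex.exists_fixed_of_fg hdim hell H hH
    by_contra hH'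
    have h0 := hX.empty H hH'
    exact Set.notMem_empty x (h0 ▸ fun h => hx h h.2)
  refine ⟨hloc, fun hfg => ?_⟩
  have htop : IsVirtuallyCyclic (⊤ : Subgroup G) := hloc ⊤ hfg.out
  have h0 := geometricDimension_eq_zero (virtuallyCyclicFamily G)
    fun H => (virtuallyCyclicFamily G).mono ⊤ htop H le_top
  rw [h0] at hG
  exact zero_ne_one hG
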